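/- Let $M=(m_{ij})$ be a Coxeter matrix of finite rank $n\ge 1$ and of finite type, i.e. such that the Coxeter group $W(M)$ is finite. Let $A=A(M)$ be the Artin group with generators $s_1,\dots,s_n$ and relations $s_is_js_i\cdots=s_js_is_j\cdots$ ($m_{ij}$ factors on each side) for $i\ne j$, $m_{ij}\neq\infty$. Let $\ell:A\to\mathbb Z$ be the homomorphism with $\ell(s_i)=1$ for all $i$. For a group $G$ let $\mathrm{Comm}(G)$ be the group of isomorphisms $\varphi:H\to K$ between finite index subgroups of $G$, two of them being identified if they agree on a finite index subgroup of $G$, under composition after restriction to suitable finite index subgroups. A transvection of $G$ is an endomorphism of the form $x\mapsto x\lambda(x)$ with $\lambda:G\to Z(G)$; an injective transvection $T$ with $[G:T(G)]<\infty$ represents an element of $\mathrm{Comm}(G)$. Then $\mathrm{Comm}(A)$ contains an infinitely generated free abelian subgroup generated by (classes of) transvections. More precisely: 1. The centre $Z(A)$ contains an element of positive length. 2. Let $\zeta\in Z(A)$ be any element of positive length and put $d=\ell(\zeta)$. There is an infinite sequence of integers $(m_i)_{i\in\mathbb N}$ such that $$|m_id+1|>1 \text{ for all } i,\qquad \gcd(m_id+1,\,m_jd+1)=1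 \text{ for all } i\neq j.$$ For every such sequence, each transvection $a\mapsto a\,\zeta^{m_i\ell(a)}$ is injective with image of finite index in $A$, and the classes of these transvections freely generate, as a free abelian group, a subgroup of $\mathrm{Comm}(A)$ that is not finitely generated. -/

import Mathlib

/-! ### The abstract commensurator of a group -/

/-- An isomorphism `dom ≃* cod` between two finite index subgroups of `G`. -/
structure FiniteIndexIso (G : Type*) [Group G] where
  dom : Subgroup G
  cod : Subgroup G
  dom_finiteIndex : dom.FiniteIndex
  cod_finiteIndex : cod.FiniteIndex
  equiv : dom ≃* cod

namespace FiniteIndexIso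

variable {G : Type*} [Group G]

/-- The isomorphism, regarded as a homomorphism from its domain to `G`. -/
def hom (φ : FiniteIndexIso G) : φ.dom →* G := φ.cod.subtype.comp φ.equiv.toMonoidHom

theorem hom_apply (φ : FiniteIndexIso G) (x : φ.dom) : φ.hom x = (φ.equiv x : G) := rfl

theorem hom_injective (φ : FiniteIndexIso G) : Function.Injective φ.hom :=
  φ.cod.subtype_injective.comp φ.equiv.injective

theorem range_hom (φ : FiniteIndexIso G) : φ.hom.range = φ.cod := by
  ext x
  constructor
  · rintro ⟨y, rfl⟩
    exact (φ.equiv y).2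
  · intro hx
    exact ⟨φ.equiv.symm ⟨x, hx⟩, by simp [hom_apply]⟩

/-- An injective homomorphism defined on a finite index subgroup, with finite index image,
regarded as an isomorphism onto its image. -/
noncomputable def ofHom (H : Subgroup G) (hH : H.FiniteIndex) (f : H →* G)
    (hf : Function.Injective f) (hr : f.range.FiniteIndex) : FiniteIndexIso G where
  dom := H
  cod := f.range
  dom_finiteIndex := hH
  cod_finiteIndex := hr
  equiv := MonoidHom.ofInjective hf

theorem ofHom_hom (H : Subgroup G) (hH : H.FiniteIndex) (f : H →* G)
    (hf : Function.Injective f) (hr : f.range.FiniteIndex) (x : H) :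
    (ofHom H hH f hf hr).hom x = f x := rfl

/-- `φ` and `ψ` agree on some finite index subgroup of `G`. -/
def Agree (φ ψ : FiniteIndexIso G) : Prop :=
  ∃ L : Subgroup G, L.FiniteIndex ∧ ∃ (h₁ : L ≤ φ.dom) (h₂ : L ≤ ψ.dom),
    ∀ (x : G) (hx : x ∈ L), φ.equiv ⟨x, h₁ hx⟩ = (ψ.equiv ⟨x, h₂ hx⟩ : G)

/-- The part of the preimage of `L` under `φ` that lies in the domain of `φ`. -/
def preimage (φ : FiniteIndexIso G) (L : Subgroup G) : Subgroup G :=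
  (L.comap φ.hom).map φ.dom.subtype

theorem mem_preimage {φ : FiniteIndexIso G} {L : Subgroup G} {x : G} :
    x ∈ φ.preimage L ↔ ∃ h : x ∈ φ.dom, φ.hom ⟨x, h⟩ ∈ L := by
  simp [preimage, Subgroup.mem_map]

theorem finiteIndex_map {H : Subgroup G} {f : H →* G} (hf : Function.Injective f)
    (hr : f.range.FiniteIndex) (L : Subgroup H) (hL : L.FiniteIndex) :
    (L.map f).FiniteIndex := by
  refine ⟨?_⟩
  rw [Subgroup.index_map_of_injective _ hf]
  exact mul_ne_zero hL.index_ne_zero hr.index_ne_zero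

theorem preimage_finiteIndex (φ : FiniteIndexIso G) (L : Subgroup G) (hL : L.FiniteIndex) :
    (φ.preimage L).FiniteIndex := by
  have h1 := φ.dom_finiteIndex
  have h2 : (L.comap φ.hom).FiniteIndex := by
    refine ⟨?_⟩
    rw [Subgroup.index_comap]
    exact fun h => hL.index_ne_zero (Subgroup.index_eq_zero_of_relIndex_eq_zero h)
  exact finiteIndex_map φ.dom.subtype_injective (by rwa [Subgroup.range_subtype]) _ h2

/-- The composite `φ ∘ ψ` of two isomorphisms between finite index subgroups, defined on the
elements `x` of the domain of `ψ` for which `ψ x` is in the domain of `φ`. -/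
noncomputable def compHom (φ ψ : FiniteIndexIso G) : ψ.preimage φ.dom →* G where
  toFun x := φ.hom ⟨ψ.hom ⟨x, (mem_preimage.1 x.2).1⟩, (mem_preimage.1 x.2).2⟩
  map_one' := by
    rw [← map_one φ.hom]
    congr 1
    exact Subtype.ext (map_one ψ.hom)
  map_mul' x y := by
    rw [← map_mul]
    congr 1
    ext
    simp only [MulMemClass.mk_mul_mk]
    rw [← map_mul]
    rfl

theorem compHom_injective (φ ψ : FiniteIndexIso G) : Function.Injective (compHom φ ψ) := by
  intro x y h
  have h1 := φ.hom_injective h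
  have h2 : ψ.hom ⟨x, (mem_preimage.1 x.2).1⟩ = ψ.hom ⟨y, (mem_preimage.1 y.2).1⟩ :=
    congrArg (fun z : φ.dom => (z : G)) h1
  have h3 := ψ.hom_injective h2
  exact Subtype.ext (congrArg (fun z : ψ.dom => (z : G)) h3)

theorem compHom_range (φ ψ : FiniteIndexIso G) : (compHom φ ψ).range.FiniteIndex := by
  have h1 := φ.dom_finiteIndex
  have h2 := φ.cod_finiteIndex
  have h3 := ψ.cod_finiteIndex
  have key := finiteIndex_map φ.hom_injective (by rwa [range_hom]) (ψ.cod.subgroupOf φ.dom)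
    inferInstance
  refine Subgroup.finiteIndex_of_le (H := (ψ.cod.subgroupOf φ.dom).map φ.hom) ?_
  rintro _ ⟨⟨z, hz⟩, hz', rfl⟩
  have hz'' : z ∈ ψ.cod := hz'
  rw [← range_hom] at hz''
  obtain ⟨w, rfl⟩ := hz''
  exact ⟨⟨w, mem_preimage.2 ⟨w.2, hz⟩⟩, rfl⟩

/-- Composition of isomorphisms between finite index subgroups, after restriction. -/
noncomputable def comp (φ ψ : FiniteIndexIso G) : FiniteIndexIso G :=
  ofHom (ψ.preimage φ.dom) (ψ.preimage_finiteIndex _ φ.dom_finiteIndex) (compHom φ ψ)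
    (compHom_injective φ ψ) (compHom_range φ ψ)

theorem mem_comp_dom {φ ψ : FiniteIndexIso G} {x : G} :
    x ∈ (comp φ ψ).dom ↔ ∃ h : x ∈ ψ.dom, ψ.hom ⟨x, h⟩ ∈ φ.dom := mem_preimage

theorem comp_hom {φ ψ : FiniteIndexIso G} {x : G} (hx : x ∈ (comp φ ψ).dom)
    (h : x ∈ ψ.dom) (h' : ψ.hom ⟨x, h⟩ ∈ φ.dom) :
    (comp φ ψ).hom ⟨x, hx⟩ = φ.hom ⟨ψ.hom ⟨x, h⟩, h'⟩ := rfl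

/-- The inverse isomorphism. -/
def inverse (φ : FiniteIndexIso G) : FiniteIndexIso G where
  dom := φ.cod
  cod := φ.dom
  dom_finiteIndex := φ.cod_finiteIndex
  cod_finiteIndex := φ.dom_finiteIndex
  equiv := φ.equiv.symm

/-- The identity isomorphism of `G`. -/
def identity (G : Type*) [Group G] : FiniteIndexIso G where
  dom := ⊤
  cod := ⊤
  dom_finiteIndex := inferInstance
  cod_finiteIndex := inferInstance
  equiv := MulEquiv.refl _

theorem agree_equivalence : Equivalence (Agree (G := G)) where
  refl φ := ⟨φ.dom, φ.dom_finiteIndex, le_rfl, le_rfl, fun _ _ => rfl⟩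
  symm := by
    rintro φ ψ ⟨L, hL, h₁, h₂, h⟩
    exact ⟨L, hL, h₂, h₁, fun x hx => (h x hx).symm⟩
  trans := by
    rintro φ ψ χ ⟨L, hL, h₁, h₂, h⟩ ⟨L', hL', h₁', h₂', h'⟩
    exact ⟨L ⊓ L', inferInstance, inf_le_left.trans h₁, inf_le_right.trans h₂',
      fun x hx => (h x hx.1).trans (h' x hx.2)⟩

instance setoid (G : Type*) [Group G] : Setoid (FiniteIndexIso G) := ⟨Agree, agree_equivalence⟩

theorem agree_comp {φ φ' ψ ψ' : FiniteIndexIso G} (h : Agree φ φ') (h' : Agree ψ ψ') :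
    Agree (comp φ ψ) (comp φ' ψ') := by
  obtain ⟨L, hL, h₁, h₂, h⟩ := h
  obtain ⟨L', hL', h₁', h₂', h'⟩ := h'
  have hp := ψ.preimage_finiteIndex L hL
  have e : ∀ x (hx : x ∈ L'), ψ.hom ⟨x, h₁' hx⟩ = ψ'.hom ⟨x, h₂' hx⟩ := h'
  have d1 : ∀ x (hx : x ∈ L'), x ∈ ψ.preimage L → ψ.hom ⟨x, h₁' hx⟩ ∈ L := fun x hx hp =>
    (mem_preimage.1 hp).2
  have d2 : ∀ x (hx : x ∈ L'), x ∈ ψ.preimage L → ψ'.hom ⟨x, h₂' hx⟩ ∈ L := fun x hx hp =>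
    e x hx ▸ d1 x hx hp
  refine ⟨L' ⊓ ψ.preimage L, inferInstance,
    fun x hx => mem_comp_dom.2 ⟨h₁' hx.1, h₁ (d1 x hx.1 hx.2)⟩,
    fun x hx => mem_comp_dom.2 ⟨h₂' hx.1, h₂ (d2 x hx.1 hx.2)⟩, fun x hx => ?_⟩
  change φ.hom ⟨ψ.hom ⟨x, h₁' hx.1⟩, _⟩ = φ'.hom ⟨ψ'.hom ⟨x, h₂' hx.1⟩, _⟩
  refine (h _ (d1 x hx.1 hx.2)).trans ?_
  change φ'.hom _ = φ'.hom _
  congr 1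
  exact Subtype.ext (e x hx.1)

theorem agree_inverse {φ ψ : FiniteIndexIso G} (h : Agree φ ψ) :
    Agree (inverse φ) (inverse ψ) := by
  obtain ⟨L, hL, h₁, h₂, h⟩ := h
  have hc := φ.cod_finiteIndex
  have key := finiteIndex_map φ.hom_injective (by rwa [range_hom]) (L.subgroupOf φ.dom)
    inferInstance
  have inv : ∀ x ∈ (L.subgroupOf φ.dom).map φ.hom, ∃ (y : G) (hy : y ∈ L),
      x = φ.equiv ⟨y, h₁ hy⟩ ∧ x = ψ.equiv ⟨y, h₂ hy⟩ := by
    rintro _ ⟨⟨y, hy⟩, hy', rfl⟩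
    exact ⟨y, hy', rfl, h y hy'⟩
  refine ⟨(L.subgroupOf φ.dom).map φ.hom, key, ?_, ?_, ?_⟩
  · intro x hx
    obtain ⟨y, hy, e, -⟩ := inv x hx
    rw [e]
    exact (φ.equiv _).2
  · intro x hx
    obtain ⟨y, hy, -, e⟩ := inv x hx
    rw [e]
    exact (ψ.equiv _).2
  · intro x hx
    obtain ⟨y, hy, e₁, e₂⟩ := inv x hx
    change ((φ.equiv.symm ⟨x, _⟩ : φ.dom) : G) = (ψ.equiv.symm ⟨x, _⟩ : ψ.dom)
    have a₁ : φ.equiv.symm ⟨x, e₁ ▸ (φ.equiv _).2⟩ = ⟨y, h₁ hy⟩ := by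
      rw [MulEquiv.symm_apply_eq]
      exact Subtype.ext e₁
    have a₂ : ψ.equiv.symm ⟨x, e₂ ▸ (ψ.equiv _).2⟩ = ⟨y, h₂ hy⟩ := by
      rw [MulEquiv.symm_apply_eq]
      exact Subtype.ext e₂
    rw [a₁, a₂]

end FiniteIndexIso

/-- The abstract commensurator `Comm(G)`: isomorphisms between finite index subgroups of `G`,
up to agreement on a finite index subgroup. -/
def AbstractCommensurator (G : Type*) [Group G] : Type _ := Quotient (FiniteIndexIso.setoid G)

namespace AbstractCommensurator

open FiniteIndexIso

variable {G : Type*} [Group G]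

/-- The class of an isomorphism between finite index subgroups. -/
def mk (φ : FiniteIndexIso G) : AbstractCommensurator G := Quotient.mk _ φ

/-- The group structure given by composition after restriction. -/
noncomputable instance : Group (AbstractCommensurator G) where
  mul := Quotient.map₂ comp fun _ _ h _ _ h' => agree_comp h h'
  one := mk (identity G)
  inv := Quotient.map inverse fun _ _ h => agree_inverse h
  mul_assoc := by
    rintro ⟨φ⟩ ⟨ψ⟩ ⟨χ⟩
    refine Quotient.sound ⟨(comp (comp φ ψ) χ).dom, (comp (comp φ ψ) χ).dom_finiteIndex,
      le_rfl, ?_, fun _ _ => rfl⟩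
    intro x hx
    obtain ⟨h1, h2⟩ := mem_comp_dom.1 hx
    obtain ⟨h3, h4⟩ := mem_comp_dom.1 h2
    exact mem_comp_dom.2 ⟨mem_comp_dom.2 ⟨h1, h3⟩, h4⟩
  one_mul := by
    rintro ⟨φ⟩
    exact Quotient.sound ⟨φ.dom, φ.dom_finiteIndex,
      fun x hx => mem_comp_dom.2 ⟨hx, Subgroup.mem_top _⟩, le_rfl, fun _ _ => rfl⟩
  mul_one := by
    rintro ⟨φ⟩
    exact Quotient.sound ⟨φ.dom, φ.dom_finiteIndex,
      fun x hx => mem_comp_dom.2 ⟨Subgroup.mem_top _, hx⟩, le_rfl, fun _ _ => rfl⟩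
  inv_mul_cancel := by
    rintro ⟨φ⟩
    refine Quotient.sound ⟨φ.dom, φ.dom_finiteIndex,
      fun x hx => mem_comp_dom.2 ⟨hx, (φ.equiv ⟨x, hx⟩).2⟩, fun _ _ => Subgroup.mem_top _, ?_⟩
    intro x hx
    change ((φ.equiv.symm (φ.equiv ⟨x, hx⟩) : φ.dom) : G) = x
    simp

theorem mk_mul_mk (φ ψ : FiniteIndexIso G) : mk φ * mk ψ = mk (comp φ ψ) := rfl

/-- The element `c` of `Comm(G)` is the class of the endomorphism `f` of `G`; that is, `f` is
injective with image of finite index, and `c` is the class of the isomorphism `f : G ≃* f(G)`. -/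
def Represents (c : AbstractCommensurator G) (f : G →* G) : Prop :=
  Function.Injective f ∧ f.range.FiniteIndex ∧
    ∃ φ : FiniteIndexIso G, φ.dom = ⊤ ∧ φ.cod = f.range ∧
      (∀ x : φ.dom, (φ.equiv x : G) = f x) ∧ c = mk φ

end AbstractCommensurator

/-! ### Transvections -/

/-- A transvection of `H` is an endomorphism of the form `x ↦ x * lam x`, where `lam` takes
values in the centre of `H`. -/
def IsTransvection {H : Type*} [Group H] (T : H →* H) : Prop :=
  ∃ lam : H → Subgroup.center H, ∀ x, T x = x * lam x

/-! ### Artin groups -/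

/-- The alternating product `a * b * a * ⋯` with `n` factors. -/
def alternatingProd {G : Type*} [Group G] (a b : G) : ℕ → G
  | 0 => 1
  | n + 1 => a * alternatingProd b a n

namespace CoxeterMatrix

variable {B : Type*} (M : CoxeterMatrix B)

/-- The braid relations `s i * s j * s i * ⋯ = s j * s i * s j * ⋯` with `M i j` factors on each
side, for `i ≠ j` and `M i j ≠ ∞`. An infinite entry of a Coxeter matrix is encoded by `0`. -/
def artinRelations : Set (FreeGroup B) :=
  {r | ∃ i j : B, i ≠ j ∧ M i j ≠ 0 ∧
    r = alternatingProd (FreeGroup.of i) (FreeGroup.of j) (M i j) *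
      (alternatingProd (FreeGroup.of j) (FreeGroup.of i) (M i j))⁻¹}

/-- The Artin group of type `M`. -/
abbrev ArtinGroup : Type _ := PresentedGroup M.artinRelations

theorem lift_alternatingProd {G : Type*} [Group G] (g : G) (i j : B) (n : ℕ) :
    FreeGroup.lift (fun _ : B => g)
      (alternatingProd (FreeGroup.of i) (FreeGroup.of j) n) = g ^ n := by
  induction n generalizing i j with
  | zero => simp [alternatingProd]
  | succ n ih => simp [alternatingProd, ih, pow_succ']

/-- The length homomorphism to `ℤ` (written multiplicatively), sending each generator to `1`. -/
def artinLengthHom : M.ArtinGroup →* Multiplicative ℤ :=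
  PresentedGroup.toGroup (f := fun _ => Multiplicative.ofAdd 1) (by
    rintro r ⟨i, j, -, -, rfl⟩
    rw [map_mul, map_inv, lift_alternatingProd, lift_alternatingProd, mul_inv_cancel])

/-- The length `ℓ(a) : ℤ` of an element of the Artin group. -/
def artinLength (a : M.ArtinGroup) : ℤ := Multiplicative.toAdd (M.artinLengthHom a)

theorem artinLength_of (i : B) : M.artinLength (PresentedGroup.of i) = 1 := by
  simp [artinLength, artinLengthHom]

theorem artinLength_mul (a b : M.ArtinGroup) :
    M.artinLength (a * b) = M.artinLength a + M.artinLength b := by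
  simp [artinLength]

/-- For a central element `ζ` and an integer `m`, the endomorphism `a ↦ a * ζ ^ (m * ℓ(a))` of
the Artin group. -/
def lengthTransvection (ζ : Subgroup.center M.ArtinGroup) (m : ℤ) :
    M.ArtinGroup →* M.ArtinGroup where
  toFun a := a * (ζ : M.ArtinGroup) ^ (m * M.artinLength a)
  map_one' := by simp [artinLength]
  map_mul' a b := by
    have hc : ∀ (k : ℤ) (x : M.ArtinGroup),
        x * (ζ : M.ArtinGroup) ^ k = (ζ : M.ArtinGroup) ^ k * x := fun k x =>
      Subgroup.mem_center_iff.1 (Subgroup.zpow_mem _ ζ.2 k) x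
    rw [artinLength_mul, mul_add, zpow_add]
    simp only [mul_assoc]
    congr 1
    rw [← mul_assoc, hc _ b, mul_assoc]

theorem isTransvection_lengthTransvection (ζ : Subgroup.center M.ArtinGroup) (m : ℤ) :
    IsTransvection (M.lengthTransvection ζ m) :=
  ⟨fun a => ζ ^ (m * M.artinLength a), fun a => by simp [lengthTransvection]⟩

end CoxeterMatrix

/-! Write `T_m` for `a ↦ a ζ ^ (m ℓ(a))` and `d = ℓ(ζ)`. Since `ℓ(T_m a) = (m d + 1) ℓ(a)`, the map
`T_m` rescales length by `u = m d + 1`. If `u ≠ 0`, an element of the kernel has length zero, and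
`T_m` fixes such elements, so `T_m` is injective; its image contains the finite index subgroup
`ℓ⁻¹(uℤ)`. The `T_m` commute. The factor `u` can be read off from the class in `Comm(A)`, because
every finite index subgroup contains elements of nonzero length. Pairwise coprime integers of
absolute value greater than one are independent in `ℚˣ`, by p-adic valuations, hence so are the
classes. As not every commensuration rescales length, "class and factor" is a subgroup of `Comm(A) ×
ℚˣ` whose fibre over `1` is trivial, rather than a map on `Comm(A)`.

A central element of positive length is `Δ²`, where `Δ` lifts the longest element `w₀` of the
Coxeter group. By Matsumoto's theorem (`prod_map_eq_of_isReduced`) the lift does not depend on the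
reduced word, so `Δ` permutes the generators by conjugation as `w₀` does, and `w₀² = 1`. Matsumoto's
theorem rests on the exchange property, obtained from an action on `W × ZMod 2` that counts
inversions modulo 2, and on the fact that `sᵢsⱼ` has order exactly `M i j`, seen in the geometric
representation. -/

open Polynomial.Chebyshev Module in
/-- The Chebyshev polynomial `S n` at `2 cos (2θ)`. -/
theorem chebyshev_S_eval_mul_sin (θ : ℝ) (n : ℤ) :
    (S ℝ n).eval (4 * Real.cos θ ^ 2 - 2) * Real.sin (2 * θ) = Real.sin ((n + 1) * (2 * θ)) := by
  rw [← S_two_mul_real_cos, Real.cos_two_mul]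
  ring_nf

/-! ### Geometric representation and the orders of products of simple reflections -/

namespace CoxeterMatrix

variable {B : Type*} (M : CoxeterMatrix B)

/-- The linear form `v ↦ 2⟨eᵢ, v⟩` of the geometric representation. -/
noncomputable def simpleCoroot (i : B) : Module.Dual ℝ (B →₀ ℝ) :=
  Finsupp.linearCombination ℝ fun j => -2 * Real.cos (Real.pi / M i j)

theorem simpleCoroot_single (i j : B) :
    M.simpleCoroot i (Finsupp.single j 1) = -2 * Real.cos (Real.pi / M i j) := by
  simp [simpleCoroot]

theorem simpleCoroot_self (i : B) : M.simpleCoroot i (Finsupp.single i 1) = 2 := by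
  simp [simpleCoroot_single]

/-- The action of a simple reflection in the geometric representation. -/
noncomputable def geometricReflection (i : B) : (B →₀ ℝ) ≃ₗ[ℝ] (B →₀ ℝ) :=
  Module.reflection (M.simpleCoroot_self i)

open Polynomial.Chebyshev Module in
theorem isLiftable_geometricReflection : M.IsLiftable M.geometricReflection := by
  intro i j
  by_cases h0 : M i j = 0
  · rw [h0, pow_zero]
  by_cases hij : i = j
  · subst hij
    rw [M.diagonal, pow_one]
    ext1 v
    exact involutive_reflection (M.simpleCoroot_self i) v
  have h1 : M i j ≠ 1 := M.off_diagonal i j hij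
  ext1 v
  -- Entry 2 is separate: there `sin (2θ) = 0`, and the Chebyshev identity cannot be divided by it.
  obtain h2 | h3 : M i j = 2 ∨ 3 ≤ M i j := by omega
  · have hi : M.simpleCoroot i (Finsupp.single j 1) = 0 := by
      simp [simpleCoroot_single, h2]
    have hj : M.simpleCoroot j (Finsupp.single i 1) = 0 := by
      simp [simpleCoroot_single, M.symmetric j i, h2]
    rw [h2, pow_two]
    simp only [geometricReflection, LinearEquiv.mul_apply, reflection_apply, map_sub, map_smul,
      hi, hj, simpleCoroot_self, LinearEquiv.coe_one, id]
    module
  set θ : ℝ := Real.pi / M i j with hθ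
  have hm : (3 : ℝ) ≤ M i j := by exact_mod_cast h3
  have hmθ : M i j * θ = Real.pi := by rw [hθ]; field_simp
  have hpos : 0 < θ := by rw [hθ]; positivity
  have hs : Real.sin (2 * θ) ≠ 0 :=
    (Real.sin_pos_of_pos_of_lt_pi (by positivity) (by nlinarith)).ne'
  have ht : 4 * Real.cos θ ^ 2 - 2 = M.simpleCoroot i (Finsupp.single j 1) *
      M.simpleCoroot j (Finsupp.single i 1) - 2 := by
    rw [simpleCoroot_single, simpleCoroot_single, M.symmetric j i]
    ring
  have key := chebyshev_S_eval_mul_sin θ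
  rw [geometricReflection, geometricReflection, reflection_mul_reflection_pow_apply _ _ _ _ _ ht]
  -- The Chebyshev indices in the power formula are halves of `M i j` rounded down. Every correction
  -- term contains `S (k - 1)` if `M i j = 2k`, and `S k + S (k - 1)` if `M i j = 2k + 1`; these
  -- vanish at `2 cos (2π / M i j)`.
  obtain ⟨k, hk⟩ := Nat.even_or_odd' (M i j)
  obtain hk | hk := hk
  · have hk' : ((M i j : ℕ) : ℤ) = 2 * k := by exact_mod_cast hk
    have hkθ : 2 * (k : ℝ) * θ = Real.pi := by
      rw [← hmθ, hk]; push_cast; ring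
    have hz : (S ℝ ((k : ℤ) - 1)).eval (4 * Real.cos θ ^ 2 - 2) = 0 := by
      have := key (k - 1)
      rw [show (((k : ℤ) - 1 : ℤ) + 1 : ℝ) * (2 * θ) = Real.pi by push_cast; linarith,
        Real.sin_pi] at this
      exact (mul_eq_zero.1 this).resolve_right hs
    have e1 : ((M i j : ℕ) - 2 : ℤ) / 2 = k - 1 := by omega
    have e2 : ((M i j : ℕ) - 1 : ℤ) / 2 = k - 1 := by omega
    rw [e1, e2, hz]
    simp
  · have hk' : ((M i j : ℕ) : ℤ) = 2 * k + 1 := by exact_mod_cast hk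
    have hkθ : 2 * (k : ℝ) * θ = Real.pi - θ := by
      rw [← hmθ, hk]; push_cast; ring
    have hz : (S ℝ (k : ℤ)).eval (4 * Real.cos θ ^ 2 - 2) +
        (S ℝ ((k : ℤ) - 1)).eval (4 * Real.cos θ ^ 2 - 2) = 0 := by
      have h := key (k - 1)
      have h' := key k
      rw [show (((k : ℤ) - 1 : ℤ) + 1 : ℝ) * (2 * θ) = Real.pi - θ by push_cast; linarith,
        Real.sin_pi_sub] at h
      rw [show (((k : ℤ) : ℝ) + 1) * (2 * θ) = θ + Real.pi by push_cast; linarith,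
        Real.sin_add_pi] at h'
      refine (mul_eq_zero.1 (?_ : _ * Real.sin (2 * θ) = 0)).resolve_right hs
      rw [add_mul, h, h']
      ring
    have e1 : ((M i j : ℕ) - 2 : ℤ) / 2 = k - 1 := by omega
    have e2 : ((M i j : ℕ) - 1 : ℤ) / 2 = k := by omega
    have e3 : ((M i j : ℕ) - 3 : ℤ) / 2 = k - 1 := by omega
    have e4 : ((M i j : ℕ) : ℤ) / 2 = k := by omega
    rw [e1, e2, e3, e4, hz]
    simp

-- Comparing coordinates of the image of `eᵢ` gives `S k + S (k - 1) = 1` and, unless `cos θ = 0`,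
-- `S (k - 1) = 0`. For finite entries at least 3 this says that rotation by `2kθ` is trivial.
open Polynomial.Chebyshev Module in
theorem dvd_of_geometricReflection_pow_eq_one {i j : B} (hij : i ≠ j) {k : ℕ}
    (hk : (M.geometricReflection i * M.geometricReflection j) ^ k = 1) : M i j ∣ k := by
  have h1 : M i j ≠ 1 := M.off_diagonal i j hij
  set θ : ℝ := Real.pi / M i j with hθ
  have hg : M.simpleCoroot j (Finsupp.single i 1) = -2 * Real.cos θ := by
    rw [simpleCoroot_single, M.symmetric j i]
  have ht : 4 * Real.cos θ ^ 2 - 2 = M.simpleCoroot i (Finsupp.single j 1) *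
      M.simpleCoroot j (Finsupp.single i 1) - 2 := by
    rw [hg, simpleCoroot_single]
    ring
  have h := reflection_mul_reflection_pow_apply_self (M.simpleCoroot_self i)
    (M.simpleCoroot_self j) k _ ht
  rw [← geometricReflection, ← geometricReflection, hk] at h
  have hi := DFunLike.congr_fun h i
  have hj := DFunLike.congr_fun h j
  simp only [LinearEquiv.coe_one, id, Finsupp.coe_add, Finsupp.coe_smul, Pi.add_apply,
    Pi.smul_apply, Finsupp.single_eq_same, Finsupp.single_eq_of_ne hij,
    Finsupp.single_eq_of_ne hij.symm, smul_eq_mul, mul_one, mul_zero, add_zero, zero_add,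
    hg] at hi hj
  -- For an infinite entry, encoded by 0, division by zero gives the right angle `θ = 0`; then `S (k
  -- - 1)` at 2 equals `k`, which forces `k = 0`.
  obtain h0 | h2 | h3 : M i j = 0 ∨ M i j = 2 ∨ 3 ≤ M i j := by omega
  · have hθ0 : θ = 0 := by simp [hθ, h0]
    rw [hθ0, Real.cos_zero] at hi hj
    norm_num [S_eval_two] at hi hj
    rw [hj]
    exact dvd_zero _
  · have hc : Real.cos θ = 0 := by simp [hθ, h2]
    rw [hc] at hi
    rw [show (4 * 0 ^ 2 - 2 : ℝ) = -2 by norm_num, S_eval_neg_two, S_eval_neg_two] at hi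
    rw [h2, ← even_iff_two_dvd]
    by_contra hodd
    rw [Nat.not_even_iff_odd] at hodd
    rw [Int.negOnePow_odd _ (by exact_mod_cast hodd),
      Int.negOnePow_even _ (by simpa [parity_simps] using hodd)] at hi
    norm_num at hi
  · have hm : (3 : ℝ) ≤ M i j := by exact_mod_cast h3
    have hmθ : M i j * θ = Real.pi := by rw [hθ]; field_simp
    have hpos : 0 < θ := by rw [hθ]; positivity
    have hs : Real.sin (2 * θ) ≠ 0 :=
      (Real.sin_pos_of_pos_of_lt_pi (by positivity) (by nlinarith)).ne'
    have hc : Real.cos θ ≠ 0 := fun h => hs (by rw [Real.sin_two_mul, h, mul_zero])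
    have hz : (S ℝ ((k : ℤ) - 1)).eval (4 * Real.cos θ ^ 2 - 2) = 0 := by
      have := hj.symm
      simpa [hc] using this
    rw [hz, add_zero] at hi
    have key1 := chebyshev_S_eval_mul_sin θ (k - 1)
    have key2 := chebyshev_S_eval_mul_sin θ k
    rw [hz, zero_mul] at key1
    rw [← hi, one_mul] at key2
    push_cast at key1 key2
    rw [sub_add_cancel] at key1
    rw [add_mul, one_mul, Real.sin_add, ← key1, zero_mul, zero_add] at key2
    have hcos : Real.cos (k * (2 * θ)) = 1 := by
      have : (1 - Real.cos (k * (2 * θ))) * Real.sin (2 * θ) = 0 := by linarith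
      linarith [(mul_eq_zero.1 this).resolve_right hs]
    obtain ⟨n, hn⟩ := (Real.cos_eq_one_iff _).1 hcos
    have : (k : ℝ) = M i j * n := by
      have h' : (n * (M i j) - k : ℝ) * (2 * θ) = 0 := by
        linear_combination hn + 2 * (n : ℝ) * hmθ
      have := (mul_eq_zero.1 h').resolve_right (by positivity)
      linarith
    have h' : (k : ℤ) = M i j * n := by exact_mod_cast this
    exact Int.natCast_dvd_natCast.1 ⟨n, h'⟩

end CoxeterMatrix

namespace CoxeterSystem

variable {B W : Type*} [Group W] {M : CoxeterMatrix B} (cs : CoxeterSystem M W)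

/-- The entries of the Coxeter matrix are the orders of the products of simple reflections. -/
theorem orderOf_simple_mul_simple (i j : B) : orderOf (cs.simple i * cs.simple j) = M i j := by
  by_cases hij : i = j
  · subst hij
    simp
  refine Nat.dvd_antisymm (orderOf_dvd_of_pow_eq_one (cs.simple_mul_simple_pow i j))
    (M.dvd_of_geometricReflection_pow_eq_one hij ?_)
  have := congrArg (cs.lift ⟨_, M.isLiftable_geometricReflection⟩)
    (pow_orderOf_eq_one (cs.simple i * cs.simple j))
  rwa [map_pow, map_mul, lift_apply_simple, lift_apply_simple, map_one] at this

end CoxeterSystem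

namespace CoxeterSystem

open List

variable {B W : Type*} [Group W] {M : CoxeterMatrix B} (cs : CoxeterSystem M W)

/-! ### The reflection cocycle -/

open scoped Classical in
/-- The action of a simple reflection `s` on `W × ZMod 2`, given by conjugation on the first
factor, where the second factor is changed exactly over `s`. -/
noncomputable def cocycleAction (i : B) : Function.End (W × ZMod 2) := fun p =>
  (cs.simple i * p.1 * cs.simple i, p.2 + if p.1 = cs.simple i then 1 else 0)

open scoped Classical in
theorem prod_cocycleAction (ω : List B) (t : W) (e : ZMod 2) :
    (ω.map cs.cocycleAction).prod (t, e) =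
      (cs.wordProd ω * t * (cs.wordProd ω)⁻¹, e + (cs.rightInvSeq ω).count t) := by
  induction ω with
  | nil => simp [Function.End.one_def]
  | cons i ω ih =>
    have h : (cs.wordProd ω * t * (cs.wordProd ω)⁻¹ = cs.simple i) ↔
        ((cs.wordProd ω)⁻¹ * cs.simple i * cs.wordProd ω = t) := by
      constructor <;> intro h
      · rw [← h]; group
      · rw [← h]; group
    simp only [mul_assoc] at h
    rw [map_cons, prod_cons]
    change cs.cocycleAction i ((ω.map cs.cocycleAction).prod (t, e)) = _
    rw [ih]
    simp only [cocycleAction, rightInvSeq, count_cons, wordProd_cons, mul_inv_rev, inv_simple, h,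
      beq_iff_eq, Nat.cast_add, Nat.cast_ite, Nat.cast_one, Nat.cast_zero, mul_assoc, add_assoc]

/-- `sⱼ` inverts the rotation `sᵢsⱼ`, so conjugation collects its powers. The left side is the entry
that the next letter adds to the right inversion sequence. -/
theorem inv_alternatingWord_mul_simple_mul (i j : B) (k : ℕ) :
    (cs.wordProd (alternatingWord i j k))⁻¹ * cs.simple (if Even k then j else i) *
      cs.wordProd (alternatingWord i j k) = cs.simple j * (cs.simple i * cs.simple j) ^ k := by
  have hconj : ∀ q : ℕ, cs.simple j * (cs.simple i * cs.simple j) ^ q =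
      ((cs.simple i * cs.simple j) ^ q)⁻¹ * cs.simple j := by
    intro q
    have h : cs.simple j * (cs.simple i * cs.simple j) * (cs.simple j)⁻¹ =
        (cs.simple i * cs.simple j)⁻¹ := by simp [mul_assoc]
    rw [← mul_inv_eq_iff_eq_mul, ← inv_pow, ← h, conj_pow]
  rw [prod_alternatingWord_eq_mul_pow]
  obtain ⟨q, rfl | rfl⟩ := Nat.even_or_odd' k
  · rw [if_pos (even_two_mul q), if_pos (even_two_mul q), one_mul,
      Nat.mul_div_cancel_left _ two_pos, ← hconj, mul_assoc, ← pow_add, two_mul]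
  · have h : ¬ Even (2 * q + 1) := by simp
    have h' : (2 * q + 1) / 2 = q := by omega
    rw [if_neg h, if_neg h, h', mul_inv_rev, inv_simple, ← hconj, two_mul, pow_succ, pow_add]
    have h1 : ∀ x : W, x * cs.simple i * cs.simple j = x * (cs.simple i * cs.simple j) :=
      fun x => mul_assoc _ _ _
    simp only [← mul_assoc]
    simp only [h1, ← pow_succ, mul_assoc, ← pow_add]
    congr 2
    omega

theorem rightInvSeq_alternatingWord (i j : B) (k : ℕ) :
    cs.rightInvSeq (alternatingWord i j k) =
      ((List.range k).map fun q => cs.simple j * (cs.simple i * cs.simple j) ^ q).reverse := by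
  induction k with
  | zero => simp [alternatingWord]
  | succ k ih =>
    rw [alternatingWord_succ', rightInvSeq, ih, inv_alternatingWord_mul_simple_mul,
      List.range_succ]
    simp

theorem prod_map_alternatingWord_two_mul {N : Type*} [Monoid N] (f : B → N) (i j : B) (k : ℕ) :
    ((alternatingWord i j (2 * k)).map f).prod = (f i * f j) ^ k := by
  induction k with
  | zero => simp [alternatingWord]
  | succ k ih =>
    rw [mul_add, mul_one, alternatingWord_succ', alternatingWord_succ', map_cons, map_cons,
      prod_cons, prod_cons, ih, pow_succ', if_neg (by simp), if_pos (by simp), mul_assoc]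

/-- The inversion sequence of `(sᵢsⱼ) ^ M i j` is periodic with period `M i j` and has twice that
length, so each reflection occurs an even number of times. -/
theorem isLiftable_cocycleAction : M.IsLiftable cs.cocycleAction := by
  classical
  intro i j
  rw [← prod_map_alternatingWord_two_mul]
  funext ⟨t, e⟩
  rw [prod_cocycleAction, rightInvSeq_alternatingWord, count_reverse, two_mul, List.range_add,
    map_append, count_append, map_map]
  have h : ((fun q => cs.simple j * (cs.simple i * cs.simple j) ^ q) ∘ fun x => M i j + x) =
      fun q => cs.simple j * (cs.simple i * cs.simple j) ^ q := by
    funext q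
    simp [pow_add]
  have h1 : cs.wordProd (alternatingWord i j (M i j + M i j)) = 1 := by
    rw [← two_mul, wordProd, prod_map_alternatingWord_two_mul, simple_mul_simple_pow]
  rw [h, h1, Nat.cast_add, CharTwo.add_self_eq_zero]
  simp [Function.End.one_def]

open scoped Classical in
/-- The parity of the number of times that a reflection occurs in the right inversion sequence
of a word depends only on the product of the word. -/
theorem count_rightInvSeq_congr {ω ω' : List B} (h : cs.wordProd ω = cs.wordProd ω') (t : W) :
    ((cs.rightInvSeq ω).count t : ZMod 2) = (cs.rightInvSeq ω').count t := by
  have key : ∀ ω : List B, (ω.map cs.cocycleAction).prod =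
      cs.lift ⟨_, cs.isLiftable_cocycleAction⟩ (cs.wordProd ω) := by
    intro ω
    rw [wordProd, map_list_prod, map_map]
    congr 2
    funext i
    simp
  have h2 := congrFun ((key ω).trans ((congrArg _ h).trans (key ω').symm)) (t, 0)
  rw [prod_cocycleAction, prod_cocycleAction] at h2
  simpa using congrArg Prod.snd h2

/-- A reflection that occurs exactly once has odd count, hence odd and nonzero count in any other
word for the same element. -/
theorem mem_rightInvSeq_of_nodup {ω ω' : List B} (h : cs.wordProd ω = cs.wordProd ω')
    (hω : (cs.rightInvSeq ω).Nodup) {t : W} (ht : t ∈ cs.rightInvSeq ω) :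
    t ∈ cs.rightInvSeq ω' := by
  classical
  by_contra hn
  have := cs.count_rightInvSeq_congr h t
  rw [count_eq_one_of_mem hω ht, count_eq_zero_of_not_mem hn] at this
  simp at this

theorem isReduced_of_nodup_rightInvSeq {ω : List B} (hω : (cs.rightInvSeq ω).Nodup) :
    cs.IsReduced ω := by
  obtain ⟨ω', hω', h⟩ := cs.exists_isReduced (cs.wordProd ω)
  have hsub : cs.rightInvSeq ω ⊆ cs.rightInvSeq ω' :=
    fun t ht => cs.mem_rightInvSeq_of_nodup h hω ht
  have hle := (hω.subperm hsub).length_le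
  rw [length_rightInvSeq, length_rightInvSeq] at hle
  refine le_antisymm (cs.length_wordProd_le ω) ?_
  rw [h, hω'.eq]
  exact hle

/-! ### Exchange property and Matsumoto's theorem -/

/-- The exchange property. -/
theorem exists_eraseIdx_of_isLeftDescent {ω : List B} {i : B}
    (h : cs.IsLeftDescent (cs.wordProd ω) i) :
    ∃ p < ω.length, cs.simple i * cs.wordProd ω = cs.wordProd (ω.eraseIdx p) := by
  obtain ⟨ν, hν, hw⟩ := cs.exists_isReduced (cs.simple i * cs.wordProd ω)
  have hω : cs.wordProd ω = cs.wordProd (i :: ν) := by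
    rw [wordProd_cons, ← hw, simple_mul_simple_cancel_left]
  have hred : cs.IsReduced (i :: ν) := by
    rw [isLeftDescent_iff, hw, hν.eq] at h
    rw [IsReduced, ← hω, ← h, length_cons]
  have hmem : cs.simple i ∈ cs.rightInvSeq ω.reverse := by
    refine cs.mem_rightInvSeq_of_nodup (ω := (i :: ν).reverse) ?_ hred.reverse.nodup_rightInvSeq ?_
    · rw [wordProd_reverse, wordProd_reverse, hω]
    · rw [rightInvSeq_reverse, leftInvSeq]
      simp
  rw [rightInvSeq_reverse, mem_reverse] at hmem
  obtain ⟨p, hp, hpe⟩ := List.mem_iff_getElem.1 hmem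
  refine ⟨p, by simpa using hp, ?_⟩
  rw [← getD_leftInvSeq_mul_wordProd, getD_eq_getElem _ _ hp, hpe]

/-- The inversions are `sⱼ` times distinct powers of `sᵢsⱼ`; this is where its exact order is
needed. -/
theorem isReduced_alternatingWord {i j : B} {k : ℕ} (hk : M i j = 0 ∨ k ≤ M i j) :
    cs.IsReduced (alternatingWord i j k) := by
  apply isReduced_of_nodup_rightInvSeq
  rw [rightInvSeq_alternatingWord, nodup_reverse]
  refine List.Nodup.map_on ?_ List.nodup_range
  intro x hx y hy hxy
  rw [List.mem_range] at hx hy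
  have h := mul_left_cancel hxy
  rw [pow_inj_mod, orderOf_simple_mul_simple] at h
  obtain h0 | h0 := hk
  · simpa [h0] using h
  · rwa [Nat.mod_eq_of_lt (hx.trans_le h0), Nat.mod_eq_of_lt (hy.trans_le h0)] at h

/-- A reduced word in the left descents of `w` is a prefix of a reduced word of `w`. -/
theorem exists_isReduced_append {w : W} {ω : List B} (hω : cs.IsReduced ω)
    (hd : ∀ i ∈ ω, cs.IsLeftDescent w i) :
    ∃ ν, cs.IsReduced (ω ++ ν) ∧ cs.wordProd (ω ++ ν) = w := by
  induction ω with
  | nil =>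
    obtain ⟨ν, hν, rfl⟩ := cs.exists_isReduced w
    exact ⟨ν, hν, rfl⟩
  | cons i ω ih =>
    obtain ⟨ν, hν, rfl⟩ := ih (hω.drop 1) fun j hj => hd j (mem_cons_of_mem _ hj)
    have hi := hd i mem_cons_self
    obtain ⟨p, hp, he⟩ := cs.exists_eraseIdx_of_isLeftDescent hi
    -- A letter erased inside `ω` would make `i :: ω` equal to a word shorter than `ω`, although it
    -- is reduced. So the erased letter lies in `ν`.
    obtain hlt | hle := lt_or_ge p ω.length
    · rw [eraseIdx_append_of_lt_length hlt, wordProd_append, wordProd_append, ← mul_assoc,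
        mul_left_inj, ← wordProd_cons] at he
      have h1 := cs.length_wordProd_le (ω.eraseIdx p)
      rw [← he, hω.eq, length_cons, length_eraseIdx_of_lt hlt] at h1
      omega
    · rw [eraseIdx_append_of_length_le hle] at he
      have hw : cs.wordProd (i :: ω ++ ν.eraseIdx (p - ω.length)) = cs.wordProd (ω ++ ν) := by
        rw [cons_append, wordProd_cons, ← he, simple_mul_simple_cancel_left]
      refine ⟨ν.eraseIdx (p - ω.length), ?_, hw⟩
      rw [length_append] at hp
      rw [IsReduced, hw, hν.eq, length_append, length_append, length_cons,
        length_eraseIdx_of_lt (by omega)]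
      omega

theorem IsReduced.isLeftDescent {cs : CoxeterSystem M W} {i : B} {ω : List B}
    (h : cs.IsReduced (i :: ω)) : cs.IsLeftDescent (cs.wordProd (i :: ω)) i := by
  rw [IsLeftDescent, h.eq, wordProd_cons, simple_mul_simple_cancel_left, length_cons]
  exact Nat.lt_succ_of_le (cs.length_wordProd_le ω)

/-- Matsumoto's theorem: a map satisfying the braid relations takes the same value on all reduced
words of an element. -/
theorem prod_map_eq_of_isReduced {G : Type*} [Monoid G] {f : B → G}
    (hf : ∀ i j, i ≠ j → M i j ≠ 0 →
      ((alternatingWord i j (M i j)).map f).prod = ((alternatingWord j i (M i j)).map f).prod)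
    {ω ω' : List B} (hω : cs.IsReduced ω) (hω' : cs.IsReduced ω')
    (h : cs.wordProd ω = cs.wordProd ω') : (ω.map f).prod = (ω'.map f).prod := by
  have hlen : ω.length = ω'.length := by rw [← hω.eq, ← hω'.eq, h]
  induction hn : ω.length generalizing ω ω' with
  | zero =>
    rw [eq_nil_of_length_eq_zero hn, eq_nil_of_length_eq_zero (hlen.symm.trans hn)]
  | succ n ih =>
    obtain ⟨i, u, rfl⟩ := exists_cons_of_length_eq_add_one hn
    obtain ⟨j, v, rfl⟩ := exists_cons_of_length_eq_add_one (hlen.symm.trans hn)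
    have same : ∀ {i : B} {u v : List B}, cs.IsReduced (i :: u) → cs.IsReduced (i :: v) →
        cs.wordProd (i :: u) = cs.wordProd (i :: v) → (i :: u).length = n + 1 →
        ((i :: u).map f).prod = ((i :: v).map f).prod := by
      intro i u v hu hv h hn
      have hl : (i :: u).length = (i :: v).length := by rw [← hu.eq, ← hv.eq, h]
      rw [map_cons, map_cons, prod_cons, prod_cons]
      rw [wordProd_cons, wordProd_cons, mul_right_inj] at h
      exact congrArg _ (ih (hu.drop 1) (hv.drop 1) h (by simpa using hl) (by simpa using hn))
    by_cases hij : i = j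
    · subst hij
      exact same hω hω' h hn
    have hdi := hω.isLeftDescent
    have hdj := hω'.isLeftDescent
    rw [← h] at hdj
    set w := cs.wordProd (i :: u) with hw
    have hmem : ∀ {x y : B} {k : ℕ} {z : B}, z ∈ alternatingWord x y k → z = x ∨ z = y := by
      intro x y k
      induction k with
      | zero => simp [alternatingWord]
      | succ k ihk =>
        intro z hz
        rw [alternatingWord_succ', mem_cons] at hz
        obtain rfl | hz := hz
        · split_ifs <;> simp
        · exact ihk hz
    have hext : ∀ k, M i j = 0 ∨ k ≤ M i j → ∃ ν, cs.IsReduced (alternatingWord i j k ++ ν) ∧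
        cs.wordProd (alternatingWord i j k ++ ν) = w := by
      intro k hk
      refine cs.exists_isReduced_append (cs.isReduced_alternatingWord hk) fun z hz => ?_
      obtain rfl | rfl := hmem hz <;> assumption
    -- Otherwise alternating words of any length would be prefixes of reduced words of `w`; length
    -- `n + 2` is already too long.
    have hM : M i j ≠ 0 := by
      intro h0
      obtain ⟨ν, hν, hνw⟩ := hext (n + 2) (Or.inl h0)
      have h1 := hν.eq
      rw [hνw, hω.eq, hn, length_append, length_alternatingWord] at h1
      omega
    obtain ⟨ν, hν, hνw⟩ := hext (M i j) (Or.inr le_rfl)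
    have hswap : cs.wordProd (alternatingWord j i (M i j) ++ ν) =
        cs.wordProd (alternatingWord i j (M i j) ++ ν) := by
      rw [wordProd_append, wordProd_append]
      congr 1
      rw [cs.wordProd_braidWord_eq i j, braidWord, M.symmetric]
    have hν' : cs.IsReduced (alternatingWord j i (M i j) ++ ν) := by
      rw [IsReduced, hswap, hν.eq]
      simp
    have hfν : ((alternatingWord i j (M i j) ++ ν).map f).prod =
        ((alternatingWord j i (M i j) ++ ν).map f).prod := by
      rw [map_append, map_append, prod_append, prod_append, hf i j hij hM]
    -- One braid word starts with `i`, the other with `j`; the parity of `m` decides which. Words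
    -- sharing a first letter are compared by induction, and `hfν` links the two braid words.
    obtain ⟨m, hm⟩ := Nat.exists_eq_succ_of_ne_zero hM
    rw [hm, Nat.succ_eq_add_one] at hν hν' hfν hνw hswap
    simp only [alternatingWord_succ'] at hν hν' hfν hνw hswap
    rw [hνw] at hswap
    by_cases he : Even m
    · simp only [he, if_true, cons_append] at hν hν' hfν hνw hswap
      rw [same hω hν' hswap.symm hn, ← hfν]
      exact (same hω' hν (h.symm.trans hνw.symm) (hlen.symm.trans hn)).symm
    · simp only [he, if_false, cons_append] at hν hν' hfν hνw hswap
      rw [same hω hν hνw.symm hn, hfν]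
      exact (same hω' hν' (h.symm.trans hswap.symm) (hlen.symm.trans hn)).symm

end CoxeterSystem

namespace CoxeterSystem

open List

variable {B W : Type*} [Group W] {M : CoxeterMatrix B} (cs : CoxeterSystem M W)

/-! ### The longest element -/

theorem exists_forall_isLeftDescent [Finite W] : ∃ w, ∀ i, cs.IsLeftDescent w i := by
  obtain ⟨w, hw⟩ := Finite.exists_max cs.length
  exact ⟨w, fun i => lt_of_le_of_ne (hw _) (cs.length_simple_mul_ne w i)⟩

variable {cs} {w₀ : W}

/-- Every letter is a left descent of `w₀`, so each reduced word extends to a reduced word of `w₀`.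
-/
theorem length_inv_mul_longest (h₀ : ∀ i, cs.IsLeftDescent w₀ i) (w : W) :
    cs.length (w⁻¹ * w₀) + cs.length w = cs.length w₀ := by
  obtain ⟨ω, hω, rfl⟩ := cs.exists_isReduced w
  obtain ⟨ν, hν, rfl⟩ := cs.exists_isReduced_append hω fun i _ => h₀ i
  have hν' : cs.IsReduced ν := by simpa using hν.drop ω.length
  rw [hν.eq, wordProd_append, inv_mul_cancel_left, hν'.eq, hω.eq, length_append, add_comm]

theorem longest_mul_self (h₀ : ∀ i, cs.IsLeftDescent w₀ i) : w₀ * w₀ = 1 := by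
  have h := length_inv_mul_longest h₀ w₀⁻¹
  rw [inv_inv, length_inv] at h
  exact cs.length_eq_zero_iff.1 (by omega)

/-- `sᵢw₀` is one shorter than `w₀`, so its complement in `w₀` has length 1. -/
theorem exists_simple_mul_longest (h₀ : ∀ i, cs.IsLeftDescent w₀ i) (i : B) :
    ∃ j, cs.simple i * w₀ = w₀ * cs.simple j := by
  have h := length_inv_mul_longest h₀ (cs.simple i * w₀)
  have h1 := cs.isLeftDescent_iff.1 (h₀ i)
  obtain ⟨j, hj⟩ := cs.length_eq_one_iff.1 (show cs.length ((cs.simple i * w₀)⁻¹ * w₀) = 1 by omega)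
  refine ⟨j, ?_⟩
  rw [← hj, mul_inv_rev, inv_simple, ← mul_assoc, mul_inv_cancel_left]

/-- The Garside element permutes the generators. -/
theorem mul_prod_map_longest {G : Type*} [Monoid G] {f : B → G}
    (hf : ∀ i j, i ≠ j → M i j ≠ 0 →
      ((alternatingWord i j (M i j)).map f).prod = ((alternatingWord j i (M i j)).map f).prod)
    (h₀ : ∀ i, cs.IsLeftDescent w₀ i) {ω : List B} (hω : cs.IsReduced ω)
    (hw : cs.wordProd ω = w₀) {i j : B} (hij : cs.simple i * w₀ = w₀ * cs.simple j) :
    f i * (ω.map f).prod = (ω.map f).prod * f j := by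
  obtain ⟨ν, hν, hνw⟩ := cs.exists_isReduced (cs.simple i * w₀)
  have hl := cs.isLeftDescent_iff.1 (h₀ i)
  rw [hνw, hν.eq] at hl
  have h1 : cs.wordProd (i :: ν) = w₀ := by
    rw [wordProd_cons, ← hνw, simple_mul_simple_cancel_left]
  have h2 : cs.wordProd (ν ++ [j]) = w₀ := by
    rw [wordProd_append, ← hνw, hij, wordProd_singleton, simple_mul_simple_cancel_right]
  have h1' : cs.IsReduced (i :: ν) := by rw [IsReduced, h1, ← hl, length_cons]
  have h2' : cs.IsReduced (ν ++ [j]) := by rw [IsReduced, h2, ← hl]; simp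
  have e1 := cs.prod_map_eq_of_isReduced hf hω h1' (hw.trans h1.symm)
  have e2 := cs.prod_map_eq_of_isReduced hf hω h2' (hw.trans h2.symm)
  rw [map_cons, prod_cons] at e1
  rw [map_append, prod_append, map_singleton, prod_singleton] at e2
  rw [e2, ← mul_assoc, ← e1, e2]

end CoxeterSystem

/-! ### The Garside element and the centre of the Artin group -/

theorem map_alternatingProd {G H : Type*} [Group G] [Group H] (φ : G →* H) (a b : G) (n : ℕ) :
    φ (alternatingProd a b n) = alternatingProd (φ a) (φ b) n := by
  induction n generalizing a b with
  | zero => simp [alternatingProd]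
  | succ n ih => simp [alternatingProd, ih]

theorem CoxeterSystem.prod_map_alternatingWord {B G : Type*} [Group G] (f : B → G) (i j : B)
    (n : ℕ) : ((alternatingWord i j n).map f).prod =
      if Even n then alternatingProd (f i) (f j) n else alternatingProd (f j) (f i) n := by
  induction n with
  | zero => simp [alternatingWord, alternatingProd]
  | succ n ih =>
    rw [alternatingWord_succ', List.map_cons, List.prod_cons, ih]
    by_cases h : Even n <;> simp [h, alternatingProd, parity_simps]

namespace CoxeterMatrix

variable {B : Type*} (M : CoxeterMatrix B)

theorem artinGroup_braid {i j : B} (hij : i ≠ j) (hM : M i j ≠ 0) :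
    alternatingProd (PresentedGroup.of i : M.ArtinGroup) (PresentedGroup.of j) (M i j) =
      alternatingProd (PresentedGroup.of j) (PresentedGroup.of i) (M i j) := by
  have h : alternatingProd (FreeGroup.of i) (FreeGroup.of j) (M i j) *
      (alternatingProd (FreeGroup.of j) (FreeGroup.of i) (M i j))⁻¹ ∈ M.artinRelations :=
    ⟨i, j, hij, hM, rfl⟩
  have h1 := PresentedGroup.one_of_mem h
  rw [map_mul, map_inv, mul_inv_eq_one, map_alternatingProd, map_alternatingProd] at h1
  exact h1

theorem artinLength_prod_map_of (ω : List B) :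
    M.artinLength (ω.map PresentedGroup.of).prod = ω.length := by
  induction ω with
  | nil => simp [artinLength]
  | cons i ω ih =>
    rw [List.map_cons, List.prod_cons, artinLength_mul, ih, artinLength_of, List.length_cons]
    push_cast
    ring

/-- The centre of an Artin group of finite type contains an element of positive length, namely
the square of the Garside element. -/
theorem exists_mem_center_artinLength_pos [Nonempty B] [Finite M.Group] :
    ∃ ζ : Subgroup.center M.ArtinGroup, 0 < M.artinLength ζ := by
  let cs := M.toCoxeterSystem
  obtain ⟨w₀, h₀⟩ := cs.exists_forall_isLeftDescent
  obtain ⟨ω, hω, hw⟩ := cs.exists_isReduced w₀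
  have hf : ∀ i j, i ≠ j → M i j ≠ 0 →
      ((CoxeterSystem.alternatingWord i j (M i j)).map
        (PresentedGroup.of : B → M.ArtinGroup)).prod =
      ((CoxeterSystem.alternatingWord j i (M i j)).map PresentedGroup.of).prod := by
    intro i j hij hM
    rw [CoxeterSystem.prod_map_alternatingWord, CoxeterSystem.prod_map_alternatingWord,
      M.artinGroup_braid hij hM]
  set Δ : M.ArtinGroup := (ω.map PresentedGroup.of).prod with hΔ
  have hc : Δ * Δ ∈ Subgroup.center M.ArtinGroup := by
    rw [← Subgroup.centralizer_univ, ← Subgroup.coe_top, ← PresentedGroup.closure_range_of,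
      Subgroup.centralizer_closure, Subgroup.mem_centralizer_iff]
    rintro _ ⟨i, rfl⟩
    obtain ⟨j, hj⟩ := CoxeterSystem.exists_simple_mul_longest h₀ i
    have hj' : cs.simple j * w₀ = w₀ * cs.simple i := by
      have h1 := CoxeterSystem.longest_mul_self h₀
      rw [← mul_right_inj w₀, ← mul_assoc, ← hj, mul_assoc, h1, mul_one, ← mul_assoc, h1, one_mul]
    rw [← mul_assoc, CoxeterSystem.mul_prod_map_longest hf h₀ hω hw.symm hj, mul_assoc,
      CoxeterSystem.mul_prod_map_longest hf h₀ hω hw.symm hj', mul_assoc]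
  refine ⟨⟨Δ * Δ, hc⟩, ?_⟩
  have hpos : 0 < ω.length := by
    obtain ⟨i⟩ := ‹Nonempty B›
    have := h₀ i
    rw [CoxeterSystem.IsLeftDescent, hw, hω.eq] at this
    omega
  rw [artinLength_mul, hΔ, artinLength_prod_map_of]
  positivity

end CoxeterMatrix

/-! ### Multipliers of a character on the commensurator -/

namespace AbstractCommensurator

open FiniteIndexIso

variable {G : Type*} [Group G]

theorem exists_represents {f : G →* G} (hf : Function.Injective f) (hr : f.range.FiniteIndex) :
    ∃ c : AbstractCommensurator G, c.Represents f := by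
  have hrange : (f.comp (⊤ : Subgroup G).subtype).range = f.range := by
    rw [MonoidHom.range_comp, Subgroup.range_subtype, ← MonoidHom.range_eq_map]
  exact ⟨_, hf, hr, ofHom ⊤ inferInstance (f.comp (⊤ : Subgroup G).subtype)
    (hf.comp (Subgroup.subtype_injective _)) (hrange ▸ hr), rfl, hrange, fun _ => rfl, rfl⟩

theorem Represents.commute {c c' : AbstractCommensurator G} {f g : G →* G}
    (hc : c.Represents f) (hc' : c'.Represents g) (h : f.comp g = g.comp f) :
    c * c' = c' * c := by
  obtain ⟨-, -, φ, hφ, -, hφf, rfl⟩ := hc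
  obtain ⟨-, -, ψ, hψ, -, hψg, rfl⟩ := hc'
  have hd : ∀ x, x ∈ φ.dom := fun x => hφ ▸ Subgroup.mem_top x
  have hd' : ∀ x, x ∈ ψ.dom := fun x => hψ ▸ Subgroup.mem_top x
  refine Quotient.sound ⟨⊤, inferInstance, fun x _ => mem_comp_dom.2 ⟨hd' x, hd _⟩,
    fun x _ => mem_comp_dom.2 ⟨hd x, hd' _⟩, fun x _ => ?_⟩
  change (φ.equiv ⟨ψ.equiv ⟨x, hd' x⟩, hd _⟩ : G) = ψ.equiv ⟨φ.equiv ⟨x, hd x⟩, hd' _⟩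
  rw [hφf, hψg, hψg, hφf]
  exact DFunLike.congr_fun h x

/-- The pairs `(c, q)` such that `c` is represented by an isomorphism that multiplies the values
of the character `χ` by `q`. -/
def multiplierSubgroup (χ : G →* Multiplicative ℤ) : Subgroup (AbstractCommensurator G × ℚˣ) where
  carrier := {p | ∃ φ : FiniteIndexIso G, p.1 = mk φ ∧
    ∀ x : φ.dom, ((χ (φ.equiv x)).toAdd : ℚ) = p.2 * (χ x).toAdd}
  one_mem' := ⟨identity G, rfl, fun x => (one_mul _).symm⟩
  mul_mem' := by
    rintro ⟨_, q⟩ ⟨_, r⟩ ⟨φ, rfl, hφ⟩ ⟨ψ, rfl, hψ⟩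
    refine ⟨comp φ ψ, rfl, fun x => ?_⟩
    obtain ⟨h, h'⟩ := mem_comp_dom.1 x.2
    have h1 := hφ ⟨ψ.equiv ⟨x, h⟩, h'⟩
    have h2 := hψ ⟨x, h⟩
    rw [h2, ← mul_assoc] at h1
    exact h1
  inv_mem' := by
    rintro ⟨_, q⟩ ⟨φ, rfl, hφ⟩
    refine ⟨inverse φ, rfl, fun x => ?_⟩
    have h := hφ (φ.equiv.symm x)
    change ((χ (φ.equiv.symm x)).toAdd : ℚ) = (q⁻¹ : ℚˣ) * (χ x).toAdd
    have hx : (φ.equiv (φ.equiv.symm x) : G) = x := congrArg _ (φ.equiv.apply_symm_apply x)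
    rw [hx] at h
    rw [h, Units.inv_mul_cancel_left]

theorem Represents.mem_multiplierSubgroup {c : AbstractCommensurator G} {f : G →* G}
    (hc : c.Represents f) {χ : G →* Multiplicative ℤ} {q : ℚˣ}
    (h : ∀ x, ((χ (f x)).toAdd : ℚ) = q * (χ x).toAdd) : (c, q) ∈ multiplierSubgroup χ := by
  obtain ⟨-, -, φ, -, -, hφ, rfl⟩ := hc
  exact ⟨φ, rfl, fun x => by rw [hφ]; exact h x⟩

/-- A positive power of `g` lies in the finite index subgroup where the representative is the
identity, and `χ` is still nontrivial on it. -/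
theorem eq_one_of_mem_multiplierSubgroup {χ : G →* Multiplicative ℤ} {g : G} (hg : χ g ≠ 1)
    {q : ℚˣ} (h : (1, q) ∈ multiplierSubgroup χ) : q = 1 := by
  obtain ⟨φ, hφ, hq⟩ := h
  obtain ⟨L, hL, h₁, h₂, h⟩ : Agree (identity G) φ := Quotient.exact hφ
  obtain ⟨n, hn, -, hmem⟩ := Subgroup.exists_pow_mem_of_index_ne_zero hL.index_ne_zero g
  have h3 := hq ⟨g ^ n, h₂ hmem⟩
  rw [← h (g ^ n) hmem] at h3
  change ((χ (g ^ n)).toAdd : ℚ) = q * (χ (g ^ n)).toAdd at h3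
  have h4 : ((χ (g ^ n)).toAdd : ℚ) ≠ 0 := by
    rw [map_pow, toAdd_pow]
    simpa [hn.ne'] using hg
  exact Units.ext (mul_right_cancel₀ h4 (by rw [← h3, Units.val_one, one_mul]))

end AbstractCommensurator

/-! ### Multiplicative independence and free abelian groups -/

/-- Pairwise coprime integers of absolute value greater than one are multiplicatively
independent. -/
theorem FreeAbelianGroup.lift_injective_of_isCoprime {ι : Type*} {u : ι → ℤ} {v : ι → ℚˣ}
    (huv : ∀ i, (v i : ℚ) = u i) (hu : ∀ i, 1 < |u i|)
    (hc : Pairwise fun i j => IsCoprime (u i) (u j)) :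
    Function.Injective (FreeAbelianGroup.lift fun i => Additive.ofMul (v i)) := by
  rw [injective_iff_map_eq_zero]
  intro x hx
  refine (FreeAbelianGroup.equivFinsupp ι).injective ?_
  rw [map_zero]
  ext i
  -- By coprimality `p` divides no other `u j`, so the p-adic valuation of the image is a nonzero
  -- multiple of the coefficient at `i`.
  obtain ⟨p, hp, hpi⟩ := Nat.exists_prime_and_dvd (n := (u i).natAbs) (by
    have := hu i
    rw [Int.abs_eq_natAbs] at this
    omega)
  have := Fact.mk hp
  have hpi' : (p : ℤ) ∣ u i := Int.natCast_dvd.2 hpi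
  have hne : ∀ j, u j ≠ 0 := fun j h => by simpa [h] using hu j
  let val : Additive ℚˣ →+ ℤ := AddMonoidHom.mk' (fun q => padicValRat p (q.toMul : ℚ))
    fun a b => by
      rw [toMul_add, Units.val_mul, padicValRat.mul a.toMul.ne_zero b.toMul.ne_zero]
  have hval : ∀ j, val (Additive.ofMul (v j)) = padicValInt p (u j) := fun j => by
    change padicValRat p (v j : ℚ) = _
    rw [huv, padicValRat.of_int]
  have hcomp : val.comp (FreeAbelianGroup.lift fun i => Additive.ofMul (v i)) =
      (padicValInt p (u i) : ℤ) • FreeAbelianGroup.coeff i := by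
    ext j
    rw [AddMonoidHom.comp_apply, FreeAbelianGroup.lift_apply_of, hval, AddMonoidHom.smul_apply]
    by_cases hij : j = i
    · subst hij
      simp [FreeAbelianGroup.coeff]
    · have hpj : ¬ (p : ℤ) ∣ u j := fun h => by
        have := (hc hij).isUnit_of_dvd' h hpi'
        exact hp.one_lt.ne' (by simpa [Int.isUnit_iff_natAbs_eq] using this)
      simp [FreeAbelianGroup.coeff, padicValInt.eq_zero_of_not_dvd hpj, hij]
  have h := DFunLike.congr_fun hcomp x
  rw [AddMonoidHom.comp_apply, hx, map_zero, AddMonoidHom.smul_apply, smul_eq_mul] at h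
  refine (mul_eq_zero.1 h.symm).resolve_left ?_
  rw [Nat.cast_eq_zero]
  have h1 := (padicValInt_dvd_iff (p := p) 1 (u i)).1 (by simpa using hpi')
  have := h1.resolve_left (hne i)
  omega

theorem FreeAbelianGroup.not_addGroup_fg (ι : Type*) [Infinite ι] :
    ¬ AddGroup.FG (FreeAbelianGroup ι) := by
  intro h
  have h1 : Module.Finite ℤ (FreeAbelianGroup ι) := Module.Finite.iff_addGroup_fg.2 h
  have h2 := Module.Finite.finite_basis (FreeAbelianGroup.basis ι)
  exact not_finite ι

/-- Commuting elements that are related by a subgroup to multiplicatively independent elements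
freely generate a free abelian group. -/
theorem exists_freeAbelianGroup_addEquiv_closure {ι C D : Type*} [Group C] [CommGroup D]
    {c : ι → C} (hcomm : ∀ i j, c i * c j = c j * c i) {v : ι → D}
    (hv : Function.Injective (FreeAbelianGroup.lift fun i => Additive.ofMul (v i)))
    {R : Subgroup (C × D)} (hR : ∀ q, (1, q) ∈ R → q = 1) (hcv : ∀ i, (c i, v i) ∈ R) :
    ∃ e : FreeAbelianGroup ι ≃+ Additive (Subgroup.closure (Set.range c)),
      ∀ i, ((e (FreeAbelianGroup.of i)).toMul : C) = c i := by
  have := Subgroup.isMulCommutative_closure (k := Set.range c) (by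
    rintro _ ⟨i, rfl⟩ _ ⟨j, rfl⟩
    exact hcomm i j)
  let : CommGroup (Subgroup.closure (Set.range c)) :=
    { (inferInstance : Group (Subgroup.closure (Set.range c))) with
      mul_comm := this.is_comm.comm }
  let F : FreeAbelianGroup ι →+ Additive (Subgroup.closure (Set.range c)) :=
    FreeAbelianGroup.lift fun i => Additive.ofMul ⟨c i, Subgroup.subset_closure ⟨i, rfl⟩⟩
  have hF : ∀ i, ((F (FreeAbelianGroup.of i)).toMul : C) = c i := fun i => by
    simp only [F, FreeAbelianGroup.lift_apply_of]
    rfl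
  set V := FreeAbelianGroup.lift fun i => Additive.ofMul (v i) with hV
  have hmem : ∀ x, (((F x).toMul : C), (V x).toMul) ∈ R := by
    intro x
    induction x using FreeAbelianGroup.induction_on with
    | zero => rw [map_zero F, map_zero V]; exact R.one_mem
    | of i => rw [hF, hV, FreeAbelianGroup.lift_apply_of]; exact hcv i
    | neg i h => rw [map_neg F, map_neg V]; exact R.inv_mem h
    | add x y hx hy => rw [map_add F, map_add V]; exact R.mul_mem hx hy
  have hinj : Function.Injective F := by
    rw [injective_iff_map_eq_zero]
    intro x hx
    have h := hmem x
    rw [hx] at h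
    exact hv (by rw [map_zero]; exact hR _ h)
  have hsurj : Function.Surjective F := by
    rintro ⟨y, hy⟩
    induction hy using Subgroup.closure_induction with
    | mem y hy =>
      obtain ⟨i, rfl⟩ := hy
      exact ⟨FreeAbelianGroup.of i, FreeAbelianGroup.lift_apply_of _ _⟩
    | one => exact ⟨0, map_zero F⟩
    | mul y z hy hz ihy ihz =>
      obtain ⟨a, ha⟩ := ihy
      obtain ⟨b, hb⟩ := ihz
      exact ⟨a + b, by rw [map_add, ha, hb]; rfl⟩
    | inv y hy ihy =>
      obtain ⟨a, ha⟩ := ihy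
      exact ⟨-a, by rw [map_neg, ha]; rfl⟩
  exact ⟨{ AddEquiv.ofBijective F ⟨hinj, hsurj⟩ with }, hF⟩

theorem Subgroup.not_fg_of_freeAbelianGroup_addEquiv {ι C : Type*} [Infinite ι] [Group C]
    {K : Subgroup C} (e : FreeAbelianGroup ι ≃+ Additive K) : ¬ K.FG := by
  intro h
  have h1 : AddGroup.FG (Additive K) :=
    GroupFG.iff_add_fg.1 ((Group.fg_iff_subgroup_fg K).2 h)
  exact FreeAbelianGroup.not_addGroup_fg ι
    (AddGroup.fg_of_surjective (f := e.symm.toAddMonoidHom) e.symm.surjective)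

/-- There are infinitely many pairwise coprime integers `1 + m * d` greater than one. -/
theorem exists_pairwise_isCoprime_mul_add_one {d : ℤ} (hd : 0 < d) :
    ∃ m : ℕ → ℤ, (∀ i, 1 < |m i * d + 1|) ∧
      Pairwise fun i j => IsCoprime (m i * d + 1) (m j * d + 1) := by
  -- As in Sylvester's sequence, each `m i * d + 1` divides all later `m j`, so the later values are
  -- 1 modulo it.
  let m : ℕ → ℤ := fun n => Nat.rec 1 (fun _ a => a * (a * d + 1)) n
  have hm : ∀ n, m (n + 1) = m n * (m n * d + 1) := fun n => rfl
  have hpos : ∀ n, 0 < m n := fun n => by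
    induction n with
    | zero => exact one_pos
    | succ n ih => rw [hm]; positivity
  have hdvd : ∀ i j, i < j → m i * d + 1 ∣ m j := by
    intro i j hij
    induction j, hij using Nat.le_induction with
    | base => exact Dvd.intro_left _ rfl
    | succ j _ ih => exact ih.mul_right _
  have hcop : ∀ i j, i < j → IsCoprime (m i * d + 1) (m j * d + 1) := by
    intro i j hij
    obtain ⟨k, hk⟩ := hdvd i j hij
    exact ⟨-(k * d), 1, by rw [hk]; ring⟩
  refine ⟨m, fun i => ?_, fun i j hij => ?_⟩
  · have := mul_pos (hpos i) hd
    rw [abs_of_pos (by omega)]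
    omega
  · obtain h | h := hij.lt_or_gt
    · exact hcop i j h
    · exact (hcop j i h).symm

/-! ### Length transvections -/

namespace CoxeterMatrix

open AbstractCommensurator

variable {B : Type*} (M : CoxeterMatrix B)

theorem lengthTransvection_apply (ζ : Subgroup.center M.ArtinGroup) (m : ℤ) (a : M.ArtinGroup) :
    M.lengthTransvection ζ m a = a * (ζ : M.ArtinGroup) ^ (m * M.artinLength a) := rfl

theorem artinLength_zpow (a : M.ArtinGroup) (k : ℤ) :
    M.artinLength (a ^ k) = k * M.artinLength a := by
  simp [artinLength]

theorem artinLength_lengthTransvection (ζ : Subgroup.center M.ArtinGroup) (m : ℤ)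
    (a : M.ArtinGroup) : M.artinLength (M.lengthTransvection ζ m a) =
      (m * M.artinLength ζ + 1) * M.artinLength a := by
  rw [lengthTransvection_apply, artinLength_mul, artinLength_zpow]
  ring

theorem lengthTransvection_comm (ζ : Subgroup.center M.ArtinGroup) (m n : ℤ) :
    (M.lengthTransvection ζ m).comp (M.lengthTransvection ζ n) =
      (M.lengthTransvection ζ n).comp (M.lengthTransvection ζ m) := by
  refine MonoidHom.ext fun a => ?_
  rw [MonoidHom.comp_apply, MonoidHom.comp_apply, lengthTransvection_apply,
    artinLength_lengthTransvection, lengthTransvection_apply M ζ n (M.lengthTransvection ζ m a),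
    artinLength_lengthTransvection, lengthTransvection_apply, lengthTransvection_apply, mul_assoc,
    mul_assoc, ← zpow_add, ← zpow_add]
  congr 2
  ring

variable {M}

theorem lengthTransvection_injective {ζ : Subgroup.center M.ArtinGroup} {m : ℤ}
    (h : m * M.artinLength ζ + 1 ≠ 0) : Function.Injective (M.lengthTransvection ζ m) := by
  rw [injective_iff_map_eq_one]
  intro a ha
  have h1 := M.artinLength_lengthTransvection ζ m a
  rw [ha, show M.artinLength 1 = 0 by simp [artinLength]] at h1
  have h2 := (mul_eq_zero.1 h1.symm).resolve_left h
  simpa [lengthTransvection_apply, h2] using ha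

theorem finiteIndex_range_lengthTransvection {ζ : Subgroup.center M.ArtinGroup} {m : ℤ}
    (h : m * M.artinLength ζ + 1 ≠ 0) : (M.lengthTransvection ζ m).range.FiniteIndex := by
  set u := m * M.artinLength ζ + 1 with hu
  let L : Subgroup (Multiplicative ℤ) := Subgroup.zpowers (Multiplicative.ofAdd u)
  have hL : L.FiniteIndex := by
    refine ⟨?_⟩
    have h1 : L = AddSubgroup.toSubgroup (AddSubgroup.zmultiples u) := rfl
    rw [h1, AddSubgroup.index_toSubgroup, Int.index_zmultiples]
    exact Int.natAbs_ne_zero.2 h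
  have hL' : (L.comap M.artinLengthHom).FiniteIndex := by
    refine ⟨?_⟩
    rw [Subgroup.index_comap]
    exact fun h => hL.index_ne_zero (Subgroup.index_eq_zero_of_relIndex_eq_zero h)
  refine Subgroup.finiteIndex_of_le (H := L.comap M.artinLengthHom) fun a ha => ?_
  obtain ⟨k, hk⟩ := Subgroup.mem_zpowers_iff.1 (Subgroup.mem_comap.1 ha)
  have hk' : M.artinLength a = k * u := by
    have := congrArg Multiplicative.toAdd hk
    rw [toAdd_zpow, toAdd_ofAdd, smul_eq_mul] at this
    exact this.symm
  -- This preimage has length `k * u - m * k * ℓ(ζ) = k`, so the transvection multiplies it by `ζ ^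
  -- (m * k)` and returns `a`.
  refine ⟨a * (ζ : M.ArtinGroup) ^ (-(m * k)), ?_⟩
  rw [lengthTransvection_apply, artinLength_mul, artinLength_zpow, hk', mul_assoc, ← zpow_add,
    mul_eq_left]
  convert! zpow_zero _
  rw [hu]
  ring

theorem exists_represents_lengthTransvection [Nonempty B] (ζ : Subgroup.center M.ArtinGroup)
    (m : ℕ → ℤ) (hm : ∀ i, 1 < |m i * M.artinLength ζ + 1|)
    (hc : Pairwise fun i j =>
      IsCoprime (m i * M.artinLength ζ + 1) (m j * M.artinLength ζ + 1)) :
    ∃ c : ℕ → AbstractCommensurator M.ArtinGroup,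
      (∀ i, (c i).Represents (M.lengthTransvection ζ (m i))) ∧
      (∃ e : FreeAbelianGroup ℕ ≃+ Additive (Subgroup.closure (Set.range c)),
        ∀ i, ((e (FreeAbelianGroup.of i)).toMul : AbstractCommensurator M.ArtinGroup) = c i) ∧
      ¬ (Subgroup.closure (Set.range c)).FG := by
  have hne : ∀ i, m i * M.artinLength ζ + 1 ≠ 0 := fun i h => by simpa [h] using hm i
  choose c hc' using fun i => exists_represents (lengthTransvection_injective (hne i))
    (finiteIndex_range_lengthTransvection (hne i))
  let v : ℕ → ℚˣ := fun i => Units.mk0 ((m i * M.artinLength ζ + 1 : ℤ) : ℚ)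
    (Int.cast_ne_zero.2 (hne i))
  obtain ⟨b⟩ := ‹Nonempty B›
  -- A generator witnesses that length is nontrivial, without which multipliers would not be
  -- determined.
  have hb : M.artinLengthHom (PresentedGroup.of b) ≠ 1 := fun h => by
    have := M.artinLength_of b
    rw [artinLength, h] at this
    simp at this
  obtain ⟨e, he⟩ := exists_freeAbelianGroup_addEquiv_closure (c := c) (v := v)
    (fun i j => (hc' i).commute (hc' j) (M.lengthTransvection_comm ζ _ _))
    (FreeAbelianGroup.lift_injective_of_isCoprime (fun _ => rfl) hm hc)
    (fun _ => eq_one_of_mem_multiplierSubgroup hb)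
    (fun i => (hc' i).mem_multiplierSubgroup fun a => by
      have := M.artinLength_lengthTransvection ζ (m i) a
      rw [artinLength, artinLength] at this
      rw [this, Int.cast_mul]
      rfl)
  exact ⟨c, hc', ⟨e, he⟩, Subgroup.not_fg_of_freeAbelianGroup_addEquiv e⟩

end CoxeterMatrix

theorem proposition3p4 {B : Type*} [Finite B] [Nonempty B] (M : CoxeterMatrix B)
    [Finite M.Group] :
    -- `Comm(A)` contains an infinitely generated free abelian subgroup generated by transvections
    (∃ (S : Set (AbstractCommensurator M.ArtinGroup)),
      (∀ c ∈ S, ∃ T : M.ArtinGroup →* M.ArtinGroup, IsTransvection T ∧ c.Represents T) ∧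
      (∃ ι : Type, Nonempty (FreeAbelianGroup ι ≃+ Additive (Subgroup.closure S))) ∧
      ¬ (Subgroup.closure S).FG) ∧
    -- the centre of `A` has elements of positive length
    (∃ ζ : Subgroup.center M.ArtinGroup, 0 < M.artinLength ζ) ∧
    ∀ ζ : Subgroup.center M.ArtinGroup, 0 < M.artinLength ζ →
      -- there are infinite sequences of pairwise coprime values of `m * d + 1`
      (∃ m : ℕ → ℤ, (∀ i, 1 < |m i * M.artinLength ζ + 1|) ∧
        Pairwise fun i j =>
          IsCoprime (m i * M.artinLength ζ + 1) (m j * M.artinLength ζ + 1)) ∧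
      -- and for each of them the transvections `a ↦ a * ζ ^ (m i * ℓ(a))` freely generate
      -- an infinitely generated free abelian subgroup of `Comm(A)`
      ∀ m : ℕ → ℤ, (∀ i, 1 < |m i * M.artinLength ζ + 1|) →
        (Pairwise fun i j =>
          IsCoprime (m i * M.artinLength ζ + 1) (m j * M.artinLength ζ + 1)) →
        ∃ c : ℕ → AbstractCommensurator M.ArtinGroup,
          (∀ i, (c i).Represents (M.lengthTransvection ζ (m i))) ∧
          (∃ e : FreeAbelianGroup ℕ ≃+ Additive (Subgroup.closure (Set.range c)),
            ∀ i, ((e (FreeAbelianGroup.of i)).toMul : AbstractCommensurator M.ArtinGroup) = c i) ∧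
          ¬ (Subgroup.closure (Set.range c)).FG := by
  obtain ⟨ζ, hζ⟩ := M.exists_mem_center_artinLength_pos
  refine ⟨?_, ⟨ζ, hζ⟩, fun ζ hζ => ⟨exists_pairwise_isCoprime_mul_add_one hζ,
    fun m hm hc => CoxeterMatrix.exists_represents_lengthTransvection ζ m hm hc⟩⟩
  obtain ⟨m, hm, hc⟩ := exists_pairwise_isCoprime_mul_add_one hζ
  obtain ⟨c, hrep, ⟨e, -⟩, hfg⟩ :=
    CoxeterMatrix.exists_represents_lengthTransvection ζ m hm hc
  refine ⟨Set.range c, ?_, ⟨ℕ, ⟨e⟩⟩, hfg⟩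
  rintro _ ⟨i, rfl⟩
  exact ⟨_, M.isTransvection_lengthTransvection ζ (m i), hrep i⟩
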